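/- Let $(V,\omega)$ be a finite-dimensional symplectic vector space over an arbitrary field $F$, i.e. $\omega$ is an alternating bilinear form on $V$ and $\omega^\flat\colon V\to V^*$, $v\mapsto\omega(\cdot,v)$, is an isomorphism. For $M\in\operatorname{End}(V)$ let $M^{*\omega}=(\omega^\flat)^{-1}M^*\omega^\flat$ be its symplectic adjoint, so $\omega(Mv,w)=\omega(v,M^{*\omega}w)$. A basis $(e_1,\dots,e_n,f_1,\dots,f_n)$ of $V$ is symplectic if $\omega(e_i,e_j)=\omega(f_i,f_j)=0$ and $\omega(e_i,f_j)=\delta_{ij}$. Call $M$ symplectically diagonalizable if $V$ has a symplectic basis consisting of eigenvectors of $M$, and call $M$ symplectically similar to $N$ if $P^{-1}MP=N$ for some automorphism $P$ of $V$ preserving $\omega$. For an alternating bilinear form $\beta$ on an extension of scalars of $V$, let $\operatorname{Pf}_\omega(\beta)$ be the Pfaffian of the matrix $(\beta(v_i,v_j))_{i,j}$, where $(v_1,\dots,v_{2n})=(e_1,f_1,\dots,e_n,f_n)$ for a symplectic basis $(e_1,\dots,e_n,f_1,\dots,f_n)$ of $V$ (the choice does not matter). Let $E$ be the identity of $V$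 and write $\omega_A(v,w)=\omega(v,Aw)$ and $(P^*\omega)(v,w)=\omega(Pv,Pw)$. The symplectic characteristic polynomial of $M$ is $$\Psi_M(s,t)=\operatorname{Pf}_\omega\bigl(\omega_{(M-sE)(M^{*\omega}-sE)-tE}\bigr)\in F[s,t].$$ Then: 1. If $M$ is symplectically diagonalizable, then $\Psi_M(s,t)=\operatorname{Pf}_\omega\bigl((M-sE)^*\omega-t\omega\bigr)$. 2. If $M$ and $N$ are symplectically diagonalizable endomorphisms of $V$, then $M$ is symplectically similar to $N$ if and only if $\Psi_M(s,t)=\Psi_N(s,t)$. 3. Every symplectically diagonalizable $M$ is symplectically similar to its symplectic adjoint $M^{*\omega}$. -/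

import Mathlib

open scoped TensorProduct

/-- A bilinear form `ω` is symplectic if it is alternating and `ω♭ : V → V*`, `v ↦ ω(·, v)`,
is an isomorphism. -/
structure IsSymplecticForm {F V : Type*} [Field F] [AddCommGroup V] [Module F V]
    (ω : LinearMap.BilinForm F V) : Prop where
  alt : ω.IsAlt
  bijective_flat : Function.Bijective (ω.flip : V →ₗ[F] Module.Dual F V)

/-- The isomorphism `ω♭ : V ≃ V*`, `v ↦ ω(·, v)`. -/
noncomputable def IsSymplecticForm.flat {F V : Type*} [Field F] [AddCommGroup V] [Module F V]
    {ω : LinearMap.BilinForm F V} (hω : IsSymplecticForm ω) : V ≃ₗ[F] Module.Dual F V :=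
  LinearEquiv.ofBijective (ω.flip : V →ₗ[F] Module.Dual F V) hω.bijective_flat

/-- The symplectic adjoint `M^{*ω} = (ω♭)⁻¹ M* ω♭`, where `M*` is the dual map of `M`. -/
noncomputable def IsSymplecticForm.adjoint {F V : Type*} [Field F] [AddCommGroup V] [Module F V]
    {ω : LinearMap.BilinForm F V} (hω : IsSymplecticForm ω) (M : Module.End F V) :
    Module.End F V :=
  hω.flat.symm.toLinearMap ∘ₗ M.dualMap ∘ₗ hω.flat.toLinearMap

theorem IsSymplecticForm.apply_adjoint {F V : Type*} [Field F] [AddCommGroup V] [Module F V]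
    {ω : LinearMap.BilinForm F V} (hω : IsSymplecticForm ω) (M : Module.End F V) (v w : V) :
    ω v (hω.adjoint M w) = ω (M v) w := by
  have h : hω.flat (hω.adjoint M w) = M.dualMap (hω.flat w) := by
    simp [IsSymplecticForm.adjoint]
  exact LinearMap.congr_fun h v

/-- `M` is symplectically similar to `N` if `P⁻¹ M P = N` for some automorphism `P` of `V`
that preserves `ω`. -/
def SymplecticallySimilar {F V : Type*} [Field F] [AddCommGroup V] [Module F V]
    (ω : LinearMap.BilinForm F V) (M N : Module.End F V) : Prop :=
  ∃ P : V ≃ₗ[F] V, (∀ v w, ω (P v) (P w) = ω v w) ∧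
    P.symm.toLinearMap ∘ₗ M ∘ₗ P.toLinearMap = N

/-- A basis `(e₁, …, eₙ, f₁, …, fₙ)`, where `eᵢ = b (i, 0)` and `fᵢ = b (i, 1)`, is symplectic if
`ω(eᵢ, eⱼ) = ω(fᵢ, fⱼ) = 0` and `ω(eᵢ, fⱼ) = δᵢⱼ`. -/
def IsSymplecticBasis {F V : Type*} [Field F] [AddCommGroup V] [Module F V]
    (ω : LinearMap.BilinForm F V) {n : ℕ} (b : Module.Basis (Fin n × Fin 2) F V) : Prop :=
  ∀ i j : Fin n, ω (b (i, 0)) (b (j, 0)) = 0 ∧ ω (b (i, 1)) (b (j, 1)) = 0 ∧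
    ω (b (i, 0)) (b (j, 1)) = if i = j then 1 else 0

/-- `M` is symplectically diagonalizable if there is a symplectic basis consisting of
eigenvectors of `M`. -/
def IsSymplecticallyDiagonalizable {F V : Type*} [Field F] [AddCommGroup V] [Module F V]
    (ω : LinearMap.BilinForm F V) (M : Module.End F V) : Prop :=
  ∃ (n : ℕ) (b : Module.Basis (Fin n × Fin 2) F V), IsSymplecticBasis ω b ∧
    ∀ k : Fin n × Fin 2, ∃ c : F, M.HasEigenvector c (b k)

/-- Every finite-dimensional symplectic vector space has a symplectic basis. -/
theorem IsSymplecticForm.exists_symplecticBasis {F V : Type*} [Field F] [AddCommGroup V]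
    [Module F V] [FiniteDimensional F V] {ω : LinearMap.BilinForm F V}
    (hω : IsSymplecticForm ω) :
    ∃ (n : ℕ) (b : Module.Basis (Fin n × Fin 2) F V), IsSymplecticBasis ω b := by
  classical
  have hneg : ∀ x y, ω x y = - ω y x := fun x y => by
    exact (hω.alt.neg_eq y x).symm
  let Q : ℕ → Prop := fun n => ∃ e f : Fin n → V, ∀ i j, ω (e i) (e j) = 0 ∧
    ω (f i) (f j) = 0 ∧ ω (e i) (f j) = if i = j then 1 else 0
  -- the standard relations imply linear independence
  have hli : ∀ n (e f : Fin n → V), (∀ i j, ω (e i) (e j) = 0 ∧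
      ω (f i) (f j) = 0 ∧ ω (e i) (f j) = if i = j then 1 else 0) →
      LinearIndependent F (fun k : Fin n × Fin 2 => if k.2 = 0 then e k.1 else f k.1) := by
    intro n e f h
    rw [Fintype.linearIndependent_iff]
    intro g hg
    have hg' : ∑ i, (g (i, 0) • e i + g (i, 1) • f i) = 0 := by
      simpa [Fintype.sum_prod_type] using hg
    rintro ⟨i, k⟩
    fin_cases k
    · have := congrArg (fun x => ω x (f i)) hg'
      simpa [h] using this
    · have := congrArg (fun x => ω (e i) x) hg'
      simpa [h] using this
  have hbound : ∀ n, Q n → n ≤ Module.finrank F V := by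
    rintro n ⟨e, f, h⟩
    have := (hli n e f h).fintype_card_le_finrank
    simp at this
    omega
  let n := Nat.findGreatest Q (Module.finrank F V)
  have hQ0 : Q 0 := ⟨Fin.elim0, Fin.elim0, fun i => i.elim0⟩
  have hn : Q n := Nat.findGreatest_spec (Nat.zero_le _) hQ0
  have hmax : ¬ Q (n + 1) := fun h => by
    have := Nat.le_findGreatest (hbound _ h) h
    change n + 1 ≤ n at this
    omega
  obtain ⟨e, f, h⟩ := hn
  -- projection to the symplectic complement
  let p : V → V := fun v => v - ∑ i, (ω v (f i) • e i - ω v (e i) • f i)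
  have hfe : ∀ i j, ω (f i) (e j) = if i = j then -1 else 0 := fun i j => by
    rw [hneg, (h j i).2.2]
    by_cases hij : i = j
    · simp [hij]
    · simp [hij, Ne.symm hij]
  have hpe : ∀ v j, ω (p v) (e j) = 0 := fun v j => by
    simp [p, h, hfe]
  have hpf : ∀ v j, ω (p v) (f j) = 0 := fun v j => by
    simp [p, h]
  have hspan : ⊤ ≤ Submodule.span F
      (Set.range (fun k : Fin n × Fin 2 => if k.2 = 0 then e k.1 else f k.1)) := by
    intro v _
    by_contra hv
    have hpv : p v ≠ 0 := by
      intro h0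
      apply hv
      have : v = ∑ i, (ω v (f i) • e i - ω v (e i) • f i) := sub_eq_zero.mp h0
      rw [this]
      refine Submodule.sum_mem _ fun i _ => Submodule.sub_mem _ ?_ ?_
      · exact Submodule.smul_mem _ _ (Submodule.subset_span ⟨(i, 0), by simp⟩)
      · exact Submodule.smul_mem _ _ (Submodule.subset_span ⟨(i, 1), by simp⟩)
    obtain ⟨w, hw⟩ : ∃ w, ω w (p v) ≠ 0 := by
      by_contra! hc
      apply hpv
      apply hω.bijective_flat.1
      ext w
      simpa using hc w
    have hw' : ω (p v) w ≠ 0 := by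
      rw [hneg]
      exact neg_ne_zero.mpr hw
    apply hmax
    let c := ω (p v) w
    have hone : ω (p v) (c⁻¹ • p w) = 1 := by
      have : ω (p v) (p w) = c := by
        change ω (p v) (w - ∑ i, (ω w (f i) • e i - ω w (e i) • f i)) = c
        simp [hpe, hpf, c]
      rw [map_smul, this]
      simp [c, hw']
    have hep : ∀ x j, ω (e j) (p x) = 0 := fun x j => by rw [hneg, hpe, neg_zero]
    have hfp : ∀ x j, ω (f j) (p x) = 0 := fun x j => by rw [hneg, hpf, neg_zero]
    refine ⟨Fin.cons (p v) e, Fin.cons (c⁻¹ • p w) f, ?_⟩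
    intro i j
    refine Fin.cases ?_ (fun i => ?_) i <;> refine Fin.cases ?_ (fun j => ?_) j
    · refine ⟨hω.alt _, hω.alt _, ?_⟩
      simpa using hone
    · refine ⟨by simp [hpe], by simp [hpf], ?_⟩
      simp [hpf, (Fin.succ_ne_zero j).symm]
    · refine ⟨by simp [hep], by simp [hfp], ?_⟩
      simp [hep, Fin.succ_ne_zero]
    · simpa using h i j
  refine ⟨n, Module.Basis.mk (hli n e f h) hspan, ?_⟩
  intro i j
  simpa using h i j

/-- The Pfaffian of a matrix whose rows and columns are indexed by
`(1,0) < (1,1) < (2,0) < (2,1) < ⋯ < (n,0) < (n,1)` (lexicographic order), as a signed sum over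
perfect matchings. A matching `{{i₁, j₁}, …, {iₙ, jₙ}}` is listed with `iₖ < jₖ` and
`i₁ < ⋯ < iₙ`, which gives the permutation `σ` with `σ (k, 0) = iₖ` and `σ (k, 1) = jₖ`. -/
def pfaffian {R : Type*} [CommRing R] {n : ℕ}
    (A : Matrix (Fin n × Fin 2) (Fin n × Fin 2) R) : R :=
  ∑ σ : Equiv.Perm (Fin n × Fin 2) with
      (∀ k, toLex (σ (k, 0)) < toLex (σ (k, 1))) ∧
      (∀ k l, k < l → toLex (σ (k, 0)) < toLex (σ (l, 0))),
    ((Equiv.Perm.sign σ : ℤ) : R) * ∏ k, A (σ (k, 0)) (σ (k, 1))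

/-- Half of the dimension of `V`. -/
noncomputable def IsSymplecticForm.halfDim {F V : Type*} [Field F] [AddCommGroup V]
    [Module F V] [FiniteDimensional F V] {ω : LinearMap.BilinForm F V}
    (hω : IsSymplecticForm ω) : ℕ :=
  hω.exists_symplecticBasis.choose

/-- Some symplectic basis of `(V, ω)`. -/
noncomputable def IsSymplecticForm.basis {F V : Type*} [Field F] [AddCommGroup V]
    [Module F V] [FiniteDimensional F V] {ω : LinearMap.BilinForm F V}
    (hω : IsSymplecticForm ω) : Module.Basis (Fin hω.halfDim × Fin 2) F V :=
  hω.exists_symplecticBasis.choose_spec.choose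

theorem IsSymplecticForm.isSymplecticBasis_basis {F V : Type*} [Field F] [AddCommGroup V]
    [Module F V] [FiniteDimensional F V] {ω : LinearMap.BilinForm F V}
    (hω : IsSymplecticForm ω) : IsSymplecticBasis ω hω.basis :=
  hω.exists_symplecticBasis.choose_spec.choose_spec

/-- `Pf_ω(β)`, for a bilinear form `β` on the extension `R ⊗ V` of `V` to a commutative
`F`-algebra `R`: the Pfaffian of the matrix `(β(vᵢ, vⱼ))ᵢⱼ`, where
`(v₁, …, v₂ₙ) = (e₁, f₁, …, eₙ, fₙ)` for a symplectic basis `(e₁, …, eₙ, f₁, …, fₙ)` of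
`(V, ω)`. -/
noncomputable def IsSymplecticForm.pf {F V : Type*} [Field F] [AddCommGroup V]
    [Module F V] [FiniteDimensional F V] {ω : LinearMap.BilinForm F V}
    (hω : IsSymplecticForm ω) {R : Type*} [CommRing R] [Algebra F R]
    (β : LinearMap.BilinForm R (R ⊗[F] V)) : R :=
  pfaffian (Matrix.of fun k l => β (1 ⊗ₜ[F] hω.basis k) (1 ⊗ₜ[F] hω.basis l))

/-- The endomorphism `M - sE` of the extension `R ⊗ V`, for a scalar `s` in `R`. -/
noncomputable def subScalar {F V : Type*} [Field F] [AddCommGroup V] [Module F V]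
    {R : Type*} [CommRing R] [Algebra F R] (M : Module.End F V) (s : R) :
    Module.End R (R ⊗[F] V) :=
  LinearMap.baseChange R M - s • (1 : Module.End R (R ⊗[F] V))

/-- The bilinear form `ω_A` on `R ⊗ V` given by `ω_A(v, w) = ω(v, A w)`, for an endomorphism `A`
of `R ⊗ V`; here `ω` also denotes its extension to `R ⊗ V`. -/
noncomputable def formOf {F V : Type*} [Field F] [AddCommGroup V] [Module F V]
    {R : Type*} [CommRing R] [Algebra F R] (ω : LinearMap.BilinForm F V)
    (A : Module.End R (R ⊗[F] V)) : LinearMap.BilinForm R (R ⊗[F] V) :=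
  (LinearMap.BilinForm.baseChange R ω).compRight A

/-- The bilinear form `(M - sE)^*ω - tω` on `R ⊗ V`, where `P^*ω(v, w) = ω(P v, P w)`. -/
noncomputable def pullbackForm {F V : Type*} [Field F] [AddCommGroup V] [Module F V]
    {R : Type*} [CommRing R] [Algebra F R] (ω : LinearMap.BilinForm F V)
    (M : Module.End F V) (s t : R) : LinearMap.BilinForm R (R ⊗[F] V) :=
  (LinearMap.BilinForm.baseChange R ω).comp (subScalar M s) (subScalar M s) -
    t • LinearMap.BilinForm.baseChange R ω

/-- `Pf_ω(ω_A)` for `A = (M - sE)(M^{*ω} - sE) - tE`, where `s` and `t` are scalars in `R`. -/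
noncomputable def IsSymplecticForm.charPf {F V : Type*} [Field F] [AddCommGroup V]
    [Module F V] [FiniteDimensional F V] {ω : LinearMap.BilinForm F V}
    (hω : IsSymplecticForm ω) {R : Type*} [CommRing R] [Algebra F R]
    (M : Module.End F V) (s t : R) : R :=
  hω.pf (formOf ω
    (subScalar M s * subScalar (hω.adjoint M) s - t • (1 : Module.End R (R ⊗[F] V))))

/-- The polynomial ring `F[s, t] = F[s][t]`. -/
abbrev PolyST (F : Type*) [Field F] : Type _ := Polynomial (Polynomial F)

/-- The variable `s` of `F[s, t]`. -/
noncomputable def varS (F : Type*) [Field F] : PolyST F := Polynomial.C Polynomial.X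

/-- The variable `t` of `F[s, t]`. -/
noncomputable def varT (F : Type*) [Field F] : PolyST F := Polynomial.X

/-- The symplectic characteristic polynomial of `M`: the polynomial
`Pf_ω(ω_{(M - sE)(M^{*ω} - sE) - tE})` in the variables `s` and `t`. -/
noncomputable def IsSymplecticForm.symplecticCharpoly {F V : Type*} [Field F] [AddCommGroup V]
    [Module F V] [FiniteDimensional F V] {ω : LinearMap.BilinForm F V}
    (hω : IsSymplecticForm ω) (M : Module.End F V) : PolyST F :=
  hω.charPf M (varS F) (varT F)

/-!
Let `M` be diagonal in a symplectic basis `b`, with `M eᵢ = aᵢ eᵢ` and `M fᵢ = bᵢ fᵢ`. Its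
symplectic adjoint is diagonal in `b` too, with `aᵢ` and `bᵢ` exchanged
(`IsSymplecticForm.adjoint_apply_basis`). Hence the forms `ω_{(M - sE)(M^{*ω} - sE) - tE}` and
`(M - sE)^*ω - tω` are equal: both are `((aᵢ - s)(bᵢ - s) - t) ω` on the plane spanned by `eᵢ` and
`fᵢ`, and these planes are orthogonal (`formOf_eq_pullbackForm`). Therefore
`Ψ_M = ∏ ((aᵢ - s)(bᵢ - s) - t)` (`IsSymplecticForm.symplecticCharpoly_eq_prod`). Unique
factorization in `t`, and then in `s`, recovers from `Ψ_M` the unordered pairs `{aᵢ, bᵢ}` up to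
order (`exists_perm_of_prod_C_sub_X_eq`, `exists_perm_fin_two_of_C_sub_X_mul_eq`). Conversely these
pairs determine `M` up to symplectic similarity, because symplectic bases are exchanged by
symplectic automorphisms, and replacing `(eᵢ, fᵢ)` by `(fᵢ, -eᵢ)` exchanges `aᵢ` and `bᵢ`
(`IsSymplecticBasis.symplecticallySimilar_of_prodShear`). The same replacement, made for all `i`,
shows that `M` is similar to its adjoint.

The formula for `Ψ_M` needs the Pfaffian in a basis other than `b`, that is,
`Pf(Pᵀ A P) = det P · Pf A` for alternating `A` over any commutative ring
(`pfaffian_transpose_mul_mul`). The sum of `sign σ ∏ₖ A (σ (k, 0)) (σ (k, 1))` over all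
permutations `σ` obeys this law by multilinearity of the determinant (`sum_pfaffianTerm_conj`), and
it is `2ⁿ n!` times the Pfaffian, because the hyperoctahedral group acts freely on the permutations
with the standard ones as representatives of the orbits (`sum_pfaffianTerm`). The factor `2ⁿ n!`
can be cancelled for generic matrices over `ℤ`, which specialize to all others.
-/

/-! ### The signed sum over all permutations -/

/-- The summand `sign σ ∏ₖ A (σ (k, 0)) (σ (k, 1))` of the Pfaffian of `A`, for an arbitrary
permutation `σ`. -/
def pfaffianTerm {R : Type*} [CommRing R] {n : ℕ}
    (A : Matrix (Fin n × Fin 2) (Fin n × Fin 2) R) (σ : Equiv.Perm (Fin n × Fin 2)) : R :=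
  ((Equiv.Perm.sign σ : ℤ) : R) * ∏ k, A (σ (k, 0)) (σ (k, 1))

theorem sum_sign_mul_prod_eq_det {R ι : Type*} [CommRing R] [Fintype ι] [DecidableEq ι]
    (P : Matrix ι ι R) (f : ι → ι) :
    ∑ σ : Equiv.Perm ι, ((Equiv.Perm.sign σ : ℤ) : R) * ∏ x, P (f x) (σ x) =
      (P.submatrix f id).det := by
  rw [← Matrix.det_transpose, Matrix.det_apply']
  rfl

theorem sum_pfaffianTerm_conj {R : Type*} [CommRing R] {n : ℕ}
    (A P : Matrix (Fin n × Fin 2) (Fin n × Fin 2) R) :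
    ∑ σ, pfaffianTerm (P.transpose * A * P) σ = P.det * ∑ σ, pfaffianTerm A σ := by
  classical
  let I := Fin n × Fin 2
  let e : (I → I) ≃ (Fin n → I × I) :=
    (Equiv.curry (Fin n) (Fin 2) I).trans (Equiv.arrowCongr (Equiv.refl _) (finTwoArrowEquiv I))
  have he0 : ∀ f k, (e f k).1 = f (k, 0) := fun f k => rfl
  have he1 : ∀ f k, (e f k).2 = f (k, 1) := fun f k => rfl
  have hent : ∀ x y, (P.transpose * A * P) x y =
      ∑ p : I × I, P p.1 x * A p.1 p.2 * P p.2 y := by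
    intro x y
    rw [Fintype.sum_prod_type_right (fun p : I × I => P p.1 x * A p.1 p.2 * P p.2 y)]
    simp only [Matrix.mul_apply, Finset.sum_mul, Matrix.transpose_apply]
    rfl
  have hprod : ∀ σ : Equiv.Perm I, ∏ k, (P.transpose * A * P) (σ (k, 0)) (σ (k, 1)) =
      ∑ f : I → I, (∏ k, A (f (k, 0)) (f (k, 1))) * ∏ x, P (f x) (σ x) := by
    intro σ
    simp_rw [hent]
    rw [Finset.prod_univ_sum, Fintype.piFinset_univ, ← e.sum_comp]
    refine Finset.sum_congr rfl fun f _ => ?_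
    rw [Fintype.prod_prod_type, ← Finset.prod_mul_distrib]
    refine Finset.prod_congr rfl fun k _ => ?_
    rw [he0, he1, Fin.prod_univ_two]
    ring
  calc ∑ σ, pfaffianTerm (P.transpose * A * P) σ
      = ∑ f : I → I, (∏ k, A (f (k, 0)) (f (k, 1))) * (P.submatrix f id).det := by
        simp_rw [pfaffianTerm, hprod, Finset.mul_sum]
        rw [Finset.sum_comm]
        refine Finset.sum_congr rfl fun f _ => ?_
        rw [← sum_sign_mul_prod_eq_det, Finset.mul_sum]
        exact Finset.sum_congr rfl fun σ _ => by ring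
    _ = ∑ τ : Equiv.Perm I, P.det * pfaffianTerm A τ := by
        symm
        refine Fintype.sum_of_injective (fun τ : Equiv.Perm I => (τ : I → I))
          DFunLike.coe_injective _ _ ?_ ?_
        · intro f hf
          have hinj : ¬ Function.Injective f := fun h =>
            hf ⟨Equiv.ofBijective f (Finite.injective_iff_bijective.mp h), rfl⟩
          obtain ⟨x, y, hxy, hne⟩ : ∃ x y, f x = f y ∧ x ≠ y := by
            simpa [Function.Injective] using hinj
          rw [Matrix.det_zero_of_row_eq hne (by ext z; simp [hxy]), mul_zero]
        · intro τ
          rw [Matrix.det_permute, pfaffianTerm]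
          ring
    _ = _ := by rw [Finset.mul_sum]

/-! ### Standard permutations and the hyperoctahedral group -/

/-- The permutations that occur in the Pfaffian: they list a perfect matching in its standard
order. -/
abbrev IsStandard {n : ℕ} (σ : Equiv.Perm (Fin n × Fin 2)) : Prop :=
  (∀ k, toLex (σ (k, 0)) < toLex (σ (k, 1))) ∧
    (∀ k l, k < l → toLex (σ (k, 0)) < toLex (σ (l, 0)))

theorem pfaffian_eq_sum_pfaffianTerm {R : Type*} [CommRing R] {n : ℕ}
    (A : Matrix (Fin n × Fin 2) (Fin n × Fin 2) R) :
    pfaffian A = ∑ σ with IsStandard σ, pfaffianTerm A σ := rfl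

theorem eq_id_of_strictMono_fin {n : ℕ} {π : Fin n → Fin n} (h : StrictMono π) : π = id :=
  (h.range_inj strictMono_id).mp (by
    rw [(Finite.surjective_of_injective h.injective).range_eq, Set.range_id])

theorem perm_fin_two_eq_swap {ε : Equiv.Perm (Fin 2)} (h : ε ≠ 1) : ε = Equiv.swap 0 1 := by
  revert ε
  decide

theorem sign_prodShear {n : ℕ} (π : Equiv.Perm (Fin n)) (ε : Fin n → Equiv.Perm (Fin 2)) :
    Equiv.Perm.sign (Equiv.prodShear π ε : Equiv.Perm (Fin n × Fin 2)) =
      ∏ k, Equiv.Perm.sign (ε k) := by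
  have h : (Equiv.prodShear π ε : Equiv.Perm (Fin n × Fin 2)) =
      Equiv.prodCongrLeft (fun _ : Fin 2 => π) * Equiv.prodCongrRight ε := by
    ext x <;> rfl
  rw [h, map_mul, Equiv.Perm.sign_prodCongrLeft, Equiv.Perm.sign_prodCongrRight]
  simp

/-- Reordering the pairs of a matching and the elements inside each pair changes the sign of the
permutation and the product of the entries of an alternating matrix by the same factor. -/
theorem pfaffianTerm_mul_prodShear {R : Type*} [CommRing R] {n : ℕ}
    {A : Matrix (Fin n × Fin 2) (Fin n × Fin 2) R} (hA : ∀ k l, A l k = -A k l)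
    (σ : Equiv.Perm (Fin n × Fin 2)) (π : Equiv.Perm (Fin n)) (ε : Fin n → Equiv.Perm (Fin 2)) :
    pfaffianTerm A (σ * Equiv.prodShear π ε) = pfaffianTerm A σ := by
  have hk : ∀ k, A ((σ * Equiv.prodShear π ε : Equiv.Perm _) (k, 0))
      ((σ * Equiv.prodShear π ε : Equiv.Perm _) (k, 1)) =
      ((Equiv.Perm.sign (ε k) : ℤ) : R) * A (σ (π k, 0)) (σ (π k, 1)) := by
    intro k
    change A (σ (π k, ε k 0)) (σ (π k, ε k 1)) = _
    by_cases h : ε k = 1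
    · simp [h]
    · rw [perm_fin_two_eq_swap h]
      simp [hA (σ (π k, 0))]
  have hs : (∏ k, ((Equiv.Perm.sign (ε k) : ℤ) : R)) * ∏ k, ((Equiv.Perm.sign (ε k) : ℤ) : R)
      = 1 := by
    rw [← Finset.prod_mul_distrib]
    refine Finset.prod_eq_one fun k _ => ?_
    rw [← Int.cast_mul, Int.units_coe_mul_self, Int.cast_one]
  have hπ : ∏ k, A (σ (π k, 0)) (σ (π k, 1)) = ∏ k, A (σ (k, 0)) (σ (k, 1)) :=
    Equiv.prod_comp π fun k => A (σ (k, 0)) (σ (k, 1))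
  rw [pfaffianTerm, pfaffianTerm, Finset.prod_congr rfl fun k _ => hk k, Finset.prod_mul_distrib,
    map_mul, sign_prodShear, hπ]
  push_cast
  linear_combination
    ((Equiv.Perm.sign σ : ℤ) : R) * (∏ k, A (σ (k, 0)) (σ (k, 1))) * hs

/-- Every permutation of `Fin n × Fin 2` is uniquely the product of a standard one and an element
`(k, j) ↦ (π k, ε k j)` of the hyperoctahedral group, which permutes the pairs `{(k, 0), (k, 1)}`. -/
theorem bijective_standard_mul_prodShear (n : ℕ) :
    Function.Bijective fun x : {σ : Equiv.Perm (Fin n × Fin 2) // IsStandard σ} ×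
        Equiv.Perm (Fin n) × (Fin n → Equiv.Perm (Fin 2)) =>
      x.1.1 * (Equiv.prodShear x.2.1 x.2.2 : Equiv.Perm (Fin n × Fin 2)) := by
  constructor
  · -- the only hyperoctahedral element between standard permutations is trivial
    have key : ∀ σ τ : Equiv.Perm (Fin n × Fin 2), IsStandard σ → IsStandard τ →
        ∀ (π : Equiv.Perm (Fin n)) (ε : Fin n → Equiv.Perm (Fin 2)),
        (∀ k j, τ (k, j) = σ (π k, ε k j)) → (∀ k, ε k = 1) ∧ π = 1 := by
      intro σ τ hσ hτ π ε h
      have hε : ∀ k, ε k = 1 := by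
        intro k
        by_contra hk
        have h1 := hτ.1 k
        rw [h, h, perm_fin_two_eq_swap hk] at h1
        exact lt_asymm h1 (by simpa using hσ.1 (π k))
      refine ⟨hε, ?_⟩
      have hσm : StrictMono fun k => toLex (σ (k, 0)) := fun k l hkl => hσ.2 k l hkl
      have hm : StrictMono π := by
        intro k l hkl
        have := hτ.2 k l hkl
        rw [h, h, hε, hε] at this
        exact hσm.lt_iff_lt.mp this
      exact DFunLike.coe_injective (eq_id_of_strictMono_fin hm)
    rintro ⟨⟨σ, hσ⟩, π, ε⟩ ⟨⟨τ, hτ⟩, ρ, δ⟩ h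
    have h' : ∀ k j, σ (π k, ε k j) = τ (ρ k, δ k j) := fun k j =>
      congrArg (fun f : Equiv.Perm (Fin n × Fin 2) => f (k, j)) h
    have := key σ τ hσ hτ (π * ρ⁻¹) (fun k => ε (ρ⁻¹ k) * (δ (ρ⁻¹ k))⁻¹) (by
      intro k j
      have := h' (ρ⁻¹ k) ((δ (ρ⁻¹ k))⁻¹ j)
      simpa using this.symm)
    obtain rfl : π = ρ := mul_inv_eq_one.mp this.2
    obtain rfl : ε = δ := by
      funext k
      have := this.1 (π k)
      simpa [mul_inv_eq_one] using this
    obtain rfl : σ = τ := mul_right_cancel h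
    rfl
  · intro τ
    -- first order each pair, then sort the pairs by their first elements
    have hne : ∀ k, toLex (τ (k, 0)) ≠ toLex (τ (k, 1)) := fun k h => by simp at h
    let ε : Fin n → Equiv.Perm (Fin 2) := fun k =>
      if toLex (τ (k, 0)) < toLex (τ (k, 1)) then 1 else Equiv.swap 0 1
    have hε : ∀ k, toLex (τ (k, ε k 0)) < toLex (τ (k, ε k 1)) := by
      intro k
      by_cases h : toLex (τ (k, 0)) < toLex (τ (k, 1))
      · simp [ε, h]
      · simpa [ε, h] using lt_of_le_of_ne (not_lt.mp h) (hne k).symm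
    let f : Fin n → Lex (Fin n × Fin 2) := fun k => toLex (τ (k, ε k 0))
    have hf : Function.Injective f := fun k l h => by
      have : (k, ε k 0) = (l, ε l 0) := τ.injective (toLex.injective h)
      exact congrArg Prod.fst this
    let π := Tuple.sort f
    have hπ : StrictMono (f ∘ π) :=
      (Tuple.monotone_sort f).strictMono_of_injective (hf.comp π.injective)
    let h : Equiv.Perm (Fin n × Fin 2) := Equiv.prodShear π (fun k => ε (π k))
    refine ⟨⟨⟨τ * h, fun k => hε (π k), fun k l hkl => hπ hkl⟩, π⁻¹, fun k => (ε k)⁻¹⟩, ?_⟩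
    have : h * Equiv.prodShear π⁻¹ (fun k => (ε k)⁻¹) = 1 := by
      ext x <;> simp [h]
    simp [mul_assoc, this]

theorem sum_pfaffianTerm {R : Type*} [CommRing R] {n : ℕ}
    {A : Matrix (Fin n × Fin 2) (Fin n × Fin 2) R} (hA : ∀ k l, A l k = -A k l) :
    ∑ σ, pfaffianTerm A σ =
      Fintype.card (Equiv.Perm (Fin n) × (Fin n → Equiv.Perm (Fin 2))) * pfaffian A := by
  rw [← (bijective_standard_mul_prodShear n).sum_comp, Fintype.sum_prod_type_right]
  simp_rw [pfaffianTerm_mul_prodShear hA]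
  rw [Finset.sum_const, nsmul_eq_mul, pfaffian_eq_sum_pfaffianTerm, Finset.card_univ,
    Finset.sum_subtype (Finset.univ.filter IsStandard) (p := IsStandard) (by simp)]

/-! ### Pfaffians under congruence -/

theorem map_pfaffian {R S : Type*} [CommRing R] [CommRing S] (φ : R →+* S) {n : ℕ}
    (A : Matrix (Fin n × Fin 2) (Fin n × Fin 2) R) : φ (pfaffian A) = pfaffian (A.map φ) := by
  simp [pfaffian, map_sum, map_prod]

theorem transpose_mul_mul_antisymm {R ι : Type*} [CommRing R] [Fintype ι] {A : Matrix ι ι R}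
    (hA : ∀ k l, A l k = -A k l) (P : Matrix ι ι R) (k l : ι) :
    (P.transpose * A * P) l k = -(P.transpose * A * P) k l := by
  have hA' : A.transpose = -A := by ext k l; exact hA k l
  have h : (P.transpose * A * P).transpose = -(P.transpose * A * P) := by
    simp [Matrix.transpose_mul, hA', Matrix.mul_assoc]
  exact congrFun (congrFun h k) l

/-- `Pf(Pᵀ A P) = det P · Pf A` for alternating `A`. The number of elements of the hyperoctahedral
group need not be cancellable in `R`, so it is cancelled for generic matrices over `ℤ`. -/
theorem pfaffian_transpose_mul_mul {R : Type*} [CommRing R] {n : ℕ}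
    {A : Matrix (Fin n × Fin 2) (Fin n × Fin 2) R} (hA : ∀ k l, A l k = -A k l)
    (hA0 : ∀ k, A k k = 0) (P : Matrix (Fin n × Fin 2) (Fin n × Fin 2) R) :
    pfaffian (P.transpose * A * P) = P.det * pfaffian A := by
  let G : Matrix (Fin n × Fin 2) (Fin n × Fin 2)
      (MvPolynomial ((Fin n × Fin 2) × (Fin n × Fin 2) ⊕ (Fin n × Fin 2) × (Fin n × Fin 2)) ℤ) :=
    fun k l => if toLex k < toLex l then MvPolynomial.X (Sum.inl (k, l))
      else if toLex l < toLex k then -MvPolynomial.X (Sum.inl (l, k)) else 0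
  let Q : Matrix (Fin n × Fin 2) (Fin n × Fin 2)
      (MvPolynomial ((Fin n × Fin 2) × (Fin n × Fin 2) ⊕ (Fin n × Fin 2) × (Fin n × Fin 2)) ℤ) :=
    fun k l => MvPolynomial.X (Sum.inr (k, l))
  let φ := MvPolynomial.eval₂Hom (Int.castRingHom R)
    (Sum.elim (fun p : (Fin n × Fin 2) × (Fin n × Fin 2) => A p.1 p.2)
      (fun p : (Fin n × Fin 2) × (Fin n × Fin 2) => P p.1 p.2))
  have hG : ∀ k l, G l k = -G k l := by
    intro k l
    dsimp only [G]
    rcases lt_trichotomy (toLex k) (toLex l) with h | h | h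
    · rw [if_neg h.not_gt, if_pos h, if_pos h]
    · obtain rfl := toLex.injective h
      simp only [lt_irrefl, if_false, neg_zero]
    · rw [if_pos h, if_neg h.not_gt, if_pos h, neg_neg]
  have hGA : G.map φ = A := by
    ext k l
    rw [Matrix.map_apply]
    dsimp only [G]
    rcases lt_trichotomy (toLex k) (toLex l) with h | h | h
    · rw [if_pos h, MvPolynomial.eval₂Hom_X']
      rfl
    · obtain rfl := toLex.injective h
      simp only [lt_irrefl, if_false, map_zero, hA0]
    · rw [if_neg h.not_gt, if_pos h, map_neg, MvPolynomial.eval₂Hom_X', hA l k]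
      rfl
  have hQP : Q.map φ = P := by
    ext k l
    rw [Matrix.map_apply, MvPolynomial.eval₂Hom_X']
    rfl
  have hgen : pfaffian (Q.transpose * G * Q) = Q.det * pfaffian G := by
    have h := sum_pfaffianTerm_conj G Q
    rw [sum_pfaffianTerm hG, sum_pfaffianTerm (transpose_mul_mul_antisymm hG Q),
      mul_left_comm] at h
    exact mul_left_cancel₀ (Nat.cast_ne_zero.mpr Fintype.card_ne_zero) h
  have := congrArg φ hgen
  rwa [map_mul, map_pfaffian, map_pfaffian, RingHom.map_det, Matrix.map_mul, Matrix.map_mul,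
    Matrix.transpose_map, RingHom.mapMatrix_apply, hGA, hQP] at this

/-- Only the identity contributes to the Pfaffian of a matrix with `2 × 2` blocks on the
diagonal. -/
theorem pfaffian_blockDiagonal {R : Type*} [CommRing R] {n : ℕ}
    {A : Matrix (Fin n × Fin 2) (Fin n × Fin 2) R} (hA : ∀ k l, k.1 ≠ l.1 → A k l = 0) :
    pfaffian A = ∏ k, A (k, 0) (k, 1) := by
  rw [pfaffian_eq_sum_pfaffianTerm, Finset.sum_eq_single 1]
  · simp [pfaffianTerm]
  · intro σ hσ hσ1
    have hstd : IsStandard σ := (Finset.mem_filter.mp hσ).2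
    by_contra hne
    have hblock : ∀ k, (σ (k, 0)).1 = (σ (k, 1)).1 := by
      intro k
      by_contra hk
      exact hne (by rw [pfaffianTerm,
        Finset.prod_eq_zero (Finset.mem_univ k) (hA _ _ hk), mul_zero])
    have hsnd : ∀ k, (σ (k, 0)).2 = 0 ∧ (σ (k, 1)).2 = 1 := by
      intro k
      have h := hstd.1 k
      rw [Prod.Lex.toLex_lt_toLex] at h
      have := hblock k
      omega
    have hm : StrictMono fun k => (σ (k, 0)).1 := by
      intro k l hkl
      have h := hstd.2 k l hkl
      rw [Prod.Lex.toLex_lt_toLex, (hsnd k).1, (hsnd l).1] at h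
      simpa using h
    have hid := congrFun (eq_id_of_strictMono_fin hm)
    apply hσ1
    ext ⟨k, j⟩ : 1
    have h0 : σ (k, 0) = (k, 0) := Prod.ext (hid k) (hsnd k).1
    have h1 : σ (k, 1) = (k, 1) := Prod.ext ((hblock k).symm.trans (hid k)) (hsnd k).2
    fin_cases j
    · exact h0
    · exact h1
  · intro h
    refine absurd (Finset.mem_filter.mpr ⟨Finset.mem_univ _, ?_, ?_⟩) h
    · intro k
      simp [Prod.Lex.toLex_lt_toLex]
    · intro k l hkl
      simpa [Prod.Lex.toLex_lt_toLex] using hkl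

/-! ### Symplectic bases -/

section SymplecticBasis

variable {F V : Type*} [Field F] [AddCommGroup V] [Module F V] {ω : LinearMap.BilinForm F V}
  {n : ℕ} {b b' : Module.Basis (Fin n × Fin 2) F V}

/-- The index of the basis vector that is dual, up to sign, to the one of index `k`: this
exchanges `eᵢ` and `fᵢ`. -/
def partner {n : ℕ} (k : Fin n × Fin 2) : Fin n × Fin 2 := (k.1, Equiv.swap 0 1 k.2)

theorem IsSymplecticBasis.apply_snd_fst (hω : ω.IsAlt) (hb : IsSymplecticBasis ω b)
    (i j : Fin n) : ω (b (i, 1)) (b (j, 0)) = if i = j then -1 else 0 := by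
  rw [← hω.neg_eq, (hb j i).2.2]
  by_cases h : i = j
  · simp [h]
  · simp [h, Ne.symm h]

theorem IsSymplecticBasis.apply_eq_apply (hω : ω.IsAlt) (hb : IsSymplecticBasis ω b)
    (hb' : IsSymplecticBasis ω b') (k l : Fin n × Fin 2) :
    ω (b k) (b l) = ω (b' k) (b' l) := by
  obtain ⟨i, x⟩ := k
  obtain ⟨j, y⟩ := l
  fin_cases x <;> fin_cases y <;>
    simp [hb i j, hb' i j, hb.apply_snd_fst hω, hb'.apply_snd_fst hω]

theorem IsSymplecticBasis.apply_eq_zero (hω : ω.IsAlt) (hb : IsSymplecticBasis ω b)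
    {k l : Fin n × Fin 2} (h : k ≠ partner l) : ω (b k) (b l) = 0 := by
  obtain ⟨i, x⟩ := k
  obtain ⟨j, y⟩ := l
  fin_cases x <;> fin_cases y <;>
    simp_all [partner, hb i j, hb.apply_snd_fst hω]

theorem IsSymplecticBasis.apply_eq_zero_of_fst_ne (hω : ω.IsAlt) (hb : IsSymplecticBasis ω b)
    {k l : Fin n × Fin 2} (h : k.1 ≠ l.1) : ω (b k) (b l) = 0 :=
  hb.apply_eq_zero hω fun hkl => h (hkl ▸ rfl)

/-- Two symplectic bases of the same size are exchanged by a symplectic automorphism, so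
endomorphisms that are diagonal in them with the same eigenvalues are symplectically similar. -/
theorem IsSymplecticBasis.symplecticallySimilar (hω : ω.IsAlt) (hb : IsSymplecticBasis ω b)
    (hb' : IsSymplecticBasis ω b') {M N : Module.End F V} {c : Fin n × Fin 2 → F}
    (hM : ∀ k, M (b k) = c k • b k) (hN : ∀ k, N (b' k) = c k • b' k) :
    SymplecticallySimilar ω M N := by
  let P : V ≃ₗ[F] V := b'.equiv b (Equiv.refl _)
  have hP : ∀ k, P (b' k) = b k := fun k => by simp [P]
  refine ⟨P, ?_, ?_⟩
  · have h : ω.comp P.toLinearMap P.toLinearMap = ω := by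
      refine LinearMap.BilinForm.ext_basis b' fun k l => ?_
      simp [hP, hb.apply_eq_apply hω hb']
    exact fun v w => LinearMap.congr_fun₂ h v w
  · refine b'.ext fun k => ?_
    have hPk : P.symm (b k) = b' k := by rw [LinearEquiv.symm_apply_eq, hP]
    simp [hP, hM, hN, hPk]

/-- Permuting the pairs `(eᵢ, fᵢ)` of a symplectic basis, and replacing some of them by
`(fᵢ, -eᵢ)`, gives a symplectic basis. -/
theorem IsSymplecticBasis.exists_prodShear (hω : ω.IsAlt) (hb : IsSymplecticBasis ω b)
    (π : Equiv.Perm (Fin n)) (ε : Fin n → Equiv.Perm (Fin 2)) :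
    ∃ b' : Module.Basis (Fin n × Fin 2) F V, IsSymplecticBasis ω b' ∧
      ∃ w : Fin n × Fin 2 → Fˣ, ∀ k, b' k = w k • b (Equiv.prodShear π ε k) := by
  let w : Fin n × Fin 2 → Fˣ := fun k => if ε k.1 ≠ 1 ∧ k.2 = 1 then -1 else 1
  let b' := (b.reindex (Equiv.prodShear π ε).symm).unitsSMul w
  have hb' : ∀ k, b' k = w k • b (Equiv.prodShear π ε k) := fun k => by
    simp [b', Module.Basis.unitsSMul_apply]
  refine ⟨b', fun i j => ?_, w, hb'⟩
  have hij : ∀ x y, π i ≠ π j → ω (b (π i, x)) (b (π j, y)) = 0 := fun x y h =>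
    hb.apply_eq_zero_of_fst_ne hω h
  simp only [hb', Equiv.prodShear_apply, Units.smul_def, map_smul, LinearMap.smul_apply,
    smul_eq_mul]
  by_cases h : i = j
  · subst h
    by_cases h1 : ε i = 1
    · simp [w, h1, hb (π i) (π i)]
    · have h2 := perm_fin_two_eq_swap h1
      simp [w, h2, hb (π i) (π i), hb.apply_snd_fst hω]
  · have h' : π i ≠ π j := fun h' => h (π.injective h')
    simp [hij _ _ h', h]

theorem IsSymplecticForm.adjoint_apply_basis (hω : IsSymplecticForm ω)
    (hb : IsSymplecticBasis ω b) {M : Module.End F V} {c : Fin n × Fin 2 → F}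
    (hM : ∀ k, M (b k) = c k • b k) (k : Fin n × Fin 2) :
    hω.adjoint M (b k) = c (partner k) • b k := by
  apply hω.bijective_flat.1
  refine b.ext fun l => ?_
  change ω (b l) (hω.adjoint M (b k)) = ω (b l) (c (partner k) • b k)
  rw [hω.apply_adjoint, hM]
  by_cases h : l = partner k
  · simp [h]
  · simp [hb.apply_eq_zero hω.alt h]

theorem IsSymplecticallyDiagonalizable.exists_basis {M : Module.End F V}
    (hM : IsSymplecticallyDiagonalizable ω M) :
    ∃ (n : ℕ) (b : Module.Basis (Fin n × Fin 2) F V) (c : Fin n × Fin 2 → F),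
      IsSymplecticBasis ω b ∧ ∀ k, M (b k) = c k • b k := by
  obtain ⟨n, b, hb, h⟩ := hM
  choose c hc using h
  exact ⟨n, b, c, hb, fun k => (hc k).apply_eq_smul⟩

theorem IsSymplecticForm.eq_halfDim [FiniteDimensional F V] (hω : IsSymplecticForm ω)
    (b : Module.Basis (Fin n × Fin 2) F V) : n = hω.halfDim := by
  have h1 := Module.finrank_eq_card_basis b
  have h2 := Module.finrank_eq_card_basis hω.basis
  simp only [Fintype.card_prod, Fintype.card_fin] at h1 h2
  omega

end SymplecticBasis

/-! ### The symplectic characteristic polynomial of a diagonal endomorphism -/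

section Charpoly

variable {F V : Type*} [Field F] [AddCommGroup V] [Module F V] {ω : LinearMap.BilinForm F V}
  {n : ℕ} {b : Module.Basis (Fin n × Fin 2) F V} {R : Type*} [CommRing R] [Algebra F R]

theorem subScalar_tmul {M : Module.End F V} {a : F} {v : V} (h : M v = a • v) (s : R) :
    subScalar M s (1 ⊗ₜ[F] v) = (algebraMap F R a - s) • (1 ⊗ₜ[F] v) := by
  rw [subScalar, LinearMap.sub_apply, LinearMap.baseChange_tmul, h,
    TensorProduct.tmul_smul, ← algebraMap_smul R a, LinearMap.smul_apply, Module.End.one_apply,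
    ← sub_smul]

theorem formOf_apply_basis (hω : IsSymplecticForm ω) (hb : IsSymplecticBasis ω b)
    {M : Module.End F V} {c : Fin n × Fin 2 → F} (hM : ∀ k, M (b k) = c k • b k) (s t : R)
    (k l : Fin n × Fin 2) :
    formOf ω (subScalar M s * subScalar (hω.adjoint M) s - t • (1 : Module.End R (R ⊗[F] V)))
        (1 ⊗ₜ b k) (1 ⊗ₜ b l) =
      ((algebraMap F R (c l) - s) * (algebraMap F R (c (partner l)) - s) - t) *
        algebraMap F R (ω (b k) (b l)) := by
  rw [formOf, LinearMap.BilinForm.compRight_apply, LinearMap.sub_apply, Module.End.mul_apply,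
    subScalar_tmul (hω.adjoint_apply_basis hb hM l), map_smul, subScalar_tmul (hM l),
    LinearMap.smul_apply, Module.End.one_apply, smul_smul, ← sub_smul, map_smul,
    LinearMap.BilinForm.baseChange_tmul, mul_one, Algebra.algebraMap_eq_smul_one (ω _ _),
    smul_eq_mul, mul_comm (algebraMap F R (c l) - s)]

theorem pullbackForm_apply_basis (hω : ω.IsAlt) (hb : IsSymplecticBasis ω b)
    {M : Module.End F V} {c : Fin n × Fin 2 → F} (hM : ∀ k, M (b k) = c k • b k) (s t : R)
    (k l : Fin n × Fin 2) :
    pullbackForm ω M s t (1 ⊗ₜ b k) (1 ⊗ₜ b l) =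
      ((algebraMap F R (c l) - s) * (algebraMap F R (c (partner l)) - s) - t) *
        algebraMap F R (ω (b k) (b l)) := by
  have h : pullbackForm ω M s t (1 ⊗ₜ b k) (1 ⊗ₜ b l) =
      ((algebraMap F R (c l) - s) * (algebraMap F R (c k) - s) - t) *
        algebraMap F R (ω (b k) (b l)) := by
    simp only [pullbackForm, LinearMap.sub_apply, LinearMap.BilinForm.comp_apply,
      subScalar_tmul (hM _), map_smul, LinearMap.smul_apply,
      LinearMap.BilinForm.baseChange_tmul, mul_one, smul_eq_mul,
      Algebra.algebraMap_eq_smul_one (ω _ _)]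
    ring
  by_cases hkl : k = partner l
  · rw [h, ← hkl]
  · rw [h, hb.apply_eq_zero hω hkl, map_zero, mul_zero, mul_zero]

theorem formOf_eq_pullbackForm (hω : IsSymplecticForm ω) (hb : IsSymplecticBasis ω b)
    {M : Module.End F V} {c : Fin n × Fin 2 → F} (hM : ∀ k, M (b k) = c k • b k) (s t : R) :
    formOf ω (subScalar M s * subScalar (hω.adjoint M) s - t • (1 : Module.End R (R ⊗[F] V))) =
      pullbackForm ω M s t := by
  refine LinearMap.BilinForm.ext_basis (b.baseChange R) fun k l => ?_
  rw [Module.Basis.baseChange_apply, Module.Basis.baseChange_apply,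
    formOf_apply_basis hω hb hM, pullbackForm_apply_basis hω.alt hb hM]

/-- A symplectic basis `b` may be used to compute the Pfaffian of a form for which the planes
spanned by `eᵢ` and `fᵢ` are orthogonal, and which is `d (i, 0) = d (i, 1)` times `ω` on the plane
of index `i`. The transition matrix from `b` to `hω.basis` has determinant `1`, as one sees from the
Pfaffian of `ω` itself. -/
theorem IsSymplecticForm.pf_eq_prod [FiniteDimensional F V] (hω : IsSymplecticForm ω)
    (hb : IsSymplecticBasis ω b) {β : LinearMap.BilinForm R (R ⊗[F] V)} {d : Fin n × Fin 2 → R}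
    (hd : ∀ k, d (partner k) = d k)
    (hβ : ∀ k l, β (1 ⊗ₜ b k) (1 ⊗ₜ b l) = d l * algebraMap F R (ω (b k) (b l))) :
    hω.pf β = ∏ i, d (i, 1) := by
  obtain rfl := hω.eq_halfDim b
  let P := (b.baseChange R).toMatrix (hω.basis.baseChange R)
  have key : ∀ (β : LinearMap.BilinForm R (R ⊗[F] V)) (d : Fin hω.halfDim × Fin 2 → R),
      (∀ k, d (partner k) = d k) →
      (∀ k l, β (1 ⊗ₜ b k) (1 ⊗ₜ b l) = d l * algebraMap F R (ω (b k) (b l))) →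
      hω.pf β = P.det * ∏ i, d (i, 1) := by
    intro β d hd hβ
    have hentry : ∀ k l, LinearMap.BilinForm.toMatrix (b.baseChange R) β k l =
        d l * algebraMap F R (ω (b k) (b l)) := fun k l => by
      simp [LinearMap.BilinForm.toMatrix_apply, hβ]
    have hpf : hω.pf β =
        pfaffian (LinearMap.BilinForm.toMatrix (hω.basis.baseChange R) β) := by
      rw [IsSymplecticForm.pf]
      congr 1
      ext k l
      simp [LinearMap.BilinForm.toMatrix_apply]
    rw [hpf, ← LinearMap.BilinForm.toMatrix_mul_basis_toMatrix (b.baseChange R)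
      (hω.basis.baseChange R) β, pfaffian_transpose_mul_mul, pfaffian_blockDiagonal]
    · simp [hentry, (hb _ _).2.2, P]
    · intro k l hkl
      rw [hentry, hb.apply_eq_zero_of_fst_ne hω.alt hkl, map_zero, mul_zero]
    · intro k l
      rw [hentry, hentry, ← hω.alt.neg_eq (b k), map_neg]
      by_cases hkl : k = partner l
      · rw [hkl, hd]
        ring
      · rw [hb.apply_eq_zero hω.alt hkl]
        simp
    · intro k
      rw [hentry, hω.alt, map_zero, mul_zero]
  have hdet : P.det = 1 := by
    have h1 := key (LinearMap.BilinForm.baseChange R ω) (fun _ => 1) (fun _ => rfl) fun k l => by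
      rw [LinearMap.BilinForm.baseChange_tmul, mul_one, one_mul, Algebra.algebraMap_eq_smul_one]
    have h2 : hω.pf (LinearMap.BilinForm.baseChange R ω) = 1 := by
      rw [IsSymplecticForm.pf, pfaffian_blockDiagonal]
      · simp [(hω.isSymplecticBasis_basis _ _).2.2]
      · intro k l hkl
        simp [hω.isSymplecticBasis_basis.apply_eq_zero_of_fst_ne hω.alt hkl]
    simpa [h2] using h1.symm
  rw [key β d hd hβ, hdet, one_mul]

theorem IsSymplecticForm.symplecticCharpoly_eq_prod [FiniteDimensional F V]
    (hω : IsSymplecticForm ω) (hb : IsSymplecticBasis ω b) {M : Module.End F V}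
    {c : Fin n × Fin 2 → F} (hM : ∀ k, M (b k) = c k • b k) :
    hω.symplecticCharpoly M = ∏ i, (Polynomial.C ((Polynomial.C (c (i, 1)) - Polynomial.X) *
      (Polynomial.C (c (i, 0)) - Polynomial.X)) - Polynomial.X) := by
  rw [IsSymplecticForm.symplecticCharpoly, IsSymplecticForm.charPf,
    hω.pf_eq_prod hb ?_ (formOf_apply_basis hω hb hM (varS F) (varT F))]
  · refine Finset.prod_congr rfl fun i _ => ?_
    simp [partner, varS, varT]
  · intro k
    simp [partner, mul_comm]

end Charpoly

/-! ### The eigenvalue pairs -/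

theorem exists_perm_of_map_univ_eq {ι α : Type*} [Fintype ι] {f g : ι → α}
    (h : Finset.univ.val.map f = Finset.univ.val.map g) :
    ∃ π : Equiv.Perm ι, ∀ i, g (π i) = f i := by
  classical
  have hcard : ∀ a, Nonempty ({i // f i = a} ≃ {i // g i = a}) := by
    intro a
    have := congrArg (Multiset.count a) h
    rw [Multiset.count_map, Multiset.count_map] at this
    refine Fintype.card_eq.mp ?_
    rw [Fintype.card_subtype, Fintype.card_subtype]
    simpa [Finset.card, eq_comm] using this
  exact ⟨Equiv.ofFiberEquiv fun a => (hcard a).some, fun i => Equiv.ofFiberEquiv_map _ i⟩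

theorem exists_perm_of_prod_C_sub_X_eq {A ι : Type*} [CommRing A] [IsDomain A] [Fintype ι]
    {p q : ι → A} (h : ∏ i, (Polynomial.C (p i) - Polynomial.X) =
      ∏ i, (Polynomial.C (q i) - Polynomial.X)) :
    ∃ π : Equiv.Perm ι, ∀ i, q (π i) = p i := by
  have hroots : ∀ r : ι → A, (∏ i, (Polynomial.C (r i) - Polynomial.X)).roots =
      Finset.univ.val.map r := by
    intro r
    have hlin : ∀ i, Polynomial.C (r i) - Polynomial.X = -(Polynomial.X - Polynomial.C (r i)) :=
      fun i => (neg_sub _ _).symm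
    rw [Polynomial.roots_prod _ _ (Finset.prod_ne_zero_iff.mpr fun i _ => by
      rw [hlin, neg_ne_zero]
      exact Polynomial.X_sub_C_ne_zero _)]
    simp_rw [hlin, Polynomial.roots_neg, Polynomial.roots_X_sub_C]
    exact Multiset.bind_singleton _ _
  exact exists_perm_of_map_univ_eq (by rw [← hroots, ← hroots, h])

/-- Evaluation at a root of the first factor shows that it agrees with one of the factors on the
right, which can then be cancelled. -/
theorem exists_perm_fin_two_of_C_sub_X_mul_eq {F : Type*} [Field F] {u v : Fin 2 → F}
    (h : (Polynomial.C (u 1) - Polynomial.X) * (Polynomial.C (u 0) - Polynomial.X) =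
      (Polynomial.C (v 1) - Polynomial.X) * (Polynomial.C (v 0) - Polynomial.X)) :
    ∃ ε : Equiv.Perm (Fin 2), ∀ j, u (ε j) = v j := by
  have hroot : ∀ x, (u 1 - x) * (u 0 - x) = (v 1 - x) * (v 0 - x) := fun x => by
    simpa using congrArg (Polynomial.eval x) h
  have hne : Polynomial.C (u 1) - Polynomial.X ≠ 0 := by
    rw [← neg_sub, neg_ne_zero]
    exact Polynomial.X_sub_C_ne_zero _
  have h1 : (v 1 - u 1) * (v 0 - u 1) = 0 := by
    rw [← hroot, sub_self, zero_mul]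
  rcases mul_eq_zero.mp h1 with h1 | h1
  · rw [sub_eq_zero.mp h1] at h
    have h0 : u 0 = v 0 := Polynomial.C_injective (sub_left_injective (mul_left_cancel₀ hne h))
    exact ⟨1, Fin.forall_fin_two.mpr ⟨h0, (sub_eq_zero.mp h1).symm⟩⟩
  · rw [sub_eq_zero.mp h1, mul_comm (Polynomial.C (v 1) - Polynomial.X)] at h
    have h0 : u 0 = v 1 := Polynomial.C_injective (sub_left_injective (mul_left_cancel₀ hne h))
    refine ⟨Equiv.swap 0 1, Fin.forall_fin_two.mpr ⟨?_, ?_⟩⟩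
    · simpa using (sub_eq_zero.mp h1).symm
    · simpa using h0

/-! ### Classification -/

section Classification

variable {F V : Type*} [Field F] [AddCommGroup V] [Module F V] {ω : LinearMap.BilinForm F V}
  {n : ℕ} {b b' : Module.Basis (Fin n × Fin 2) F V}

/-- Endomorphisms that are diagonal in symplectic bases are symplectically similar if their
eigenvalue pairs agree up to the order of the pairs and the order inside each pair. -/
theorem IsSymplecticBasis.symplecticallySimilar_of_prodShear (hω : ω.IsAlt)
    (hb : IsSymplecticBasis ω b) (hb' : IsSymplecticBasis ω b') {M N : Module.End F V}
    {c c' : Fin n × Fin 2 → F} (hM : ∀ k, M (b k) = c k • b k)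
    (hN : ∀ k, N (b' k) = c' k • b' k) {π : Equiv.Perm (Fin n)}
    {ε : Fin n → Equiv.Perm (Fin 2)} (hc : ∀ k, c (Equiv.prodShear π ε k) = c' k) :
    SymplecticallySimilar ω M N := by
  obtain ⟨a, ha, w, hw⟩ := hb.exists_prodShear hω π ε
  refine ha.symplecticallySimilar hω hb' (fun k => ?_) hN
  rw [hw, Units.smul_def, map_smul, hM, hc, smul_comm]

theorem SymplecticallySimilar.symplecticCharpoly_eq [FiniteDimensional F V]
    (hω : IsSymplecticForm ω) {M N : Module.End F V} (hM : IsSymplecticallyDiagonalizable ω M)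
    (h : SymplecticallySimilar ω M N) : hω.symplecticCharpoly M = hω.symplecticCharpoly N := by
  obtain ⟨n, b, c, hb, hMb⟩ := hM.exists_basis
  obtain ⟨P, hP, rfl⟩ := h
  have hP' : ∀ v w, ω (P.symm v) (P.symm w) = ω v w := fun v w => by
    rw [← hP, P.apply_symm_apply, P.apply_symm_apply]
  have hb' : IsSymplecticBasis ω (b.map P.symm) := fun i j => by
    simpa [hP'] using hb i j
  rw [hω.symplecticCharpoly_eq_prod hb hMb,
    hω.symplecticCharpoly_eq_prod (c := c) hb' fun k => by simp [hMb]]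

theorem symplecticallySimilar_of_symplecticCharpoly_eq [FiniteDimensional F V]
    (hω : IsSymplecticForm ω) {M N : Module.End F V} (hM : IsSymplecticallyDiagonalizable ω M)
    (hN : IsSymplecticallyDiagonalizable ω N)
    (h : hω.symplecticCharpoly M = hω.symplecticCharpoly N) : SymplecticallySimilar ω M N := by
  obtain ⟨n, b, c, hb, hMb⟩ := hM.exists_basis
  obtain ⟨m, b', c', hb', hNb⟩ := hN.exists_basis
  obtain rfl : m = n := (hω.eq_halfDim b').trans (hω.eq_halfDim b).symm
  rw [hω.symplecticCharpoly_eq_prod hb hMb, hω.symplecticCharpoly_eq_prod hb' hNb] at h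
  obtain ⟨π, hπ⟩ := exists_perm_of_prod_C_sub_X_eq h.symm
  choose ε hε using fun i => exists_perm_fin_two_of_C_sub_X_mul_eq
    (u := fun j => c (π i, j)) (v := fun j => c' (i, j)) (hπ i)
  exact hb.symplecticallySimilar_of_prodShear hω.alt hb' hMb hNb (π := π) (ε := ε)
    fun k => hε k.1 k.2

theorem IsSymplecticallyDiagonalizable.symplecticallySimilar_adjoint (hω : IsSymplecticForm ω)
    {M : Module.End F V} (hM : IsSymplecticallyDiagonalizable ω M) :
    SymplecticallySimilar ω M (hω.adjoint M) := by
  obtain ⟨n, b, c, hb, hMb⟩ := hM.exists_basis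
  exact hb.symplecticallySimilar_of_prodShear hω.alt hb hMb (hω.adjoint_apply_basis hb hMb)
    (π := 1) (ε := fun _ => Equiv.swap 0 1) fun k => rfl

end Classification

theorem mainTheorem2 {F V : Type*} [Field F] [AddCommGroup V] [Module F V]
    [FiniteDimensional F V] (ω : LinearMap.BilinForm F V) (hω : IsSymplecticForm ω) :
    (∀ M : Module.End F V, IsSymplecticallyDiagonalizable ω M →
      hω.symplecticCharpoly M = hω.pf (pullbackForm ω M (varS F) (varT F))) ∧
    (∀ M N : Module.End F V, IsSymplecticallyDiagonalizable ω M →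
      IsSymplecticallyDiagonalizable ω N →
      (SymplecticallySimilar ω M N ↔ hω.symplecticCharpoly M = hω.symplecticCharpoly N)) ∧
    (∀ M : Module.End F V, IsSymplecticallyDiagonalizable ω M →
      SymplecticallySimilar ω M (hω.adjoint M)) := by
  refine ⟨fun M hM => ?_, fun M N hM hN => ⟨fun h => h.symplecticCharpoly_eq hω hM,
    symplecticallySimilar_of_symplecticCharpoly_eq hω hM hN⟩,
    fun M hM => hM.symplecticallySimilar_adjoint hω⟩
  obtain ⟨n, b, c, hb, hMb⟩ := hM.exists_basis
  exact congrArg hω.pf (formOf_eq_pullbackForm hω hb hMb (varS F) (varT F))
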